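/- Let $\alpha>-1$ and let $f:\mathbb R\to\mathbb C$ be even with $\int_0^\infty|f(x)|\,dx<\infty$ and, if $-1<\alpha<0$, also $\int_0^\infty |f(x)|\max\{1/x,1\}\,dx<\infty$ (that is, $f\in L^1_{e,w,\alpha}(\mathbb R)$). Assume further that $f\in L^2(\mathbb R)$, that $f$ is continuous, and that $f$ has an integrable first derivative $f'\in L^1(\mathbb R)$ (in the weak sense). Write $\hat f(y)=\mathcal F f(y)=\int_{\mathbb R}e^{ixy}f(x)\,dx$, $\operatorname{sinc}(t)=\sin(\pi t)/(\pi t)$ for $t\neq0$, $\operatorname{sinc}(0)=1$, and let $\operatorname{rect}(t)=1$ for $|t|<1/2$, $\operatorname{rect}(t)=1/2$ for $|t|=1/2$, $\operatorname{rect}(t)=0$ for $|t|>1/2$. For $R>0$ and an integer $N\ge1$ define $$\widehat{f^{(N)}_R}(y)=\sum_{n=-N}^{N}\hat f\Big(n\frac RN\Big)\operatorname{sinc}\Big(\frac NR y-n\Big),\qquad f^{(N)}_R(x)=\frac{R}{2\pi N}\operatorname{rect}\Big(\frac{xR}{2\pi N}\Big)\sum_{n=-N}^{N}\hat f\Big(n\frac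 RN\Big)e^{-ixnR/N}.$$ Then $\hat f$, $\widehat{f^{(N)}_R}$ and $f^{(N)}_R$ belong to $L^2(\mathbb R)$ and, with $R$, $N$ and $B>0$ coupled by $2B=N/R$ (so $R=N/(2B)$): (i) $\displaystyle\lim_{B\to\infty}\lim_{N\to\infty}\big\|\hat f-\widehat{f^{(N)}_R}\big\|_2=0$; (ii) $\displaystyle\lim_{B\to\infty}\lim_{N\to\infty}\big\|f-f^{(N)}_R\big\|_2=0$. Here, in both cases, the inner limit $N\to\infty$ is taken with $B$ fixed; it exists and is finite for every $B>0$. -/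

import Mathlib

open MeasureTheory Filter Topology Set
open scoped NNReal ENNReal ContDiff

noncomputable section

namespace AlphaSine

/-- The weighted space `L¹_{w,α}(ℝ₊)`: integrable functions on `(0, ∞)` which, for `α < 0`, are
also integrable with respect to the measure `max (1/x) 1 dx` on `(0, ∞)`. -/
def MemL1Weighted (α : ℝ) (f : ℝ → ℂ) : Prop :=
  IntegrableOn f (Ioi 0) volume ∧
    (α < 0 →
      Integrable f ((volume.restrict (Ioi (0 : ℝ))).withDensity
        fun x => ENNReal.ofReal (max (1 / x) 1)))

/-- `L¹_{e,w,α}(ℝ)`: even extensions to `ℝ` of functions in `L¹_{w,α}(ℝ₊)`. -/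
def MemL1EvenWeighted (α : ℝ) (f : ℝ → ℂ) : Prop :=
  Function.Even f ∧ MemL1Weighted α f

/-- `g` is the weak (Sobolev) derivative of `f` on `ℝ`. -/
def HasWeakDeriv (f g : ℝ → ℂ) : Prop :=
  LocallyIntegrable f volume ∧ LocallyIntegrable g volume ∧
    ∀ φ : ℝ → ℝ, ContDiff ℝ ∞ φ → HasCompactSupport φ →
      ∫ x, ((deriv φ x : ℝ) : ℂ) * f x = -∫ x, ((φ x : ℝ) : ℂ) * g x

/-- The Fourier transform `𝓕 v (y) = ∫ e^{ixy} v(x) dx` of an integrable function. -/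
def fourierTransform (v : ℝ → ℂ) (y : ℝ) : ℂ :=
  ∫ x : ℝ, Complex.exp (Complex.I * (x : ℂ) * (y : ℂ)) * v x

/-- The normalized cardinal sine `sin (π t) / (π t)`. -/
def nsinc (t : ℝ) : ℝ :=
  if t = 0 then 1 else Real.sin (Real.pi * t) / (Real.pi * t)

/-- The rectangular function of the interval `[-1/2, 1/2]`. -/
def rect (t : ℝ) : ℝ :=
  if |t| < 1 / 2 then 1 else if |t| = 1 / 2 then 1 / 2 else 0

/-- The band-limited interpolation
`∑_{n=-N}^{N} 𝓕f(n R / N) sinc(N y / R - n)` of `𝓕f`. -/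
def bandlimitedInterp (f : ℝ → ℂ) (R : ℝ) (N : ℕ) (y : ℝ) : ℂ :=
  ∑ n ∈ Finset.Icc (-(N : ℤ)) (N : ℤ),
    fourierTransform f ((n : ℝ) * (R / (N : ℝ))) * ((nsinc ((N : ℝ) / R * y - (n : ℝ)) : ℝ) : ℂ)

/-- The estimate
`R / (2πN) rect(x R / (2πN)) ∑_{n=-N}^{N} 𝓕f(n R / N) e^{-i x n R / N}` of `f`. -/
def estimate (f : ℝ → ℂ) (R : ℝ) (N : ℕ) (x : ℝ) : ℂ :=
  ((R / (2 * Real.pi * (N : ℝ)) * rect (x * R / (2 * Real.pi * (N : ℝ))) : ℝ) : ℂ) *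
    ∑ n ∈ Finset.Icc (-(N : ℤ)) (N : ℤ),
      fourierTransform f ((n : ℝ) * (R / (N : ℝ))) *
        Complex.exp (-(Complex.I * ((x * ((n : ℝ) * (R / (N : ℝ))) : ℝ) : ℂ)))

/-- `lim_{B → ∞} lim_{N → ∞} a B N = 0`: for every `B > 0` the inner limit exists and is finite,
and the inner limits tend to `0` as `B → ∞`. -/
def IteratedLimitZero (a : ℝ → ℕ → ℝ≥0∞) : Prop :=
  ∃ l : ℝ → ℝ≥0,
    (∀ B : ℝ, 0 < B → Tendsto (fun N : ℕ => a B N) atTop (𝓝 (l B : ℝ≥0∞))) ∧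
      Tendsto l atTop (𝓝 0)

end AlphaSine

end

noncomputable section

open scoped FourierTransform SchwartzMap

namespace AlphaSine

/-! ### Plancherel's theorem for functions in `L¹ ∩ L²` -/

/-! Put `T = 2πN/R = 4πB`. With `B` fixed the sampling step `R/N = 1/(2B) = 2π/T` does not depend on
`N`. By Poisson summation the numbers `T⁻¹ 𝓕f(2πn/T)` are, up to `n ↦ -n`, the Fourier coefficients
of the `T`-periodization of `f`. The estimate is therefore, almost everywhere, the `N`-th symmetric
Fourier partial sum of that periodization, cut off to one period around `0`. Convergence of Fourier
series in `L²` identifies the inner limit in (ii): it is the `L²` distance from `f` to its truncated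
periodization.

This distance tends to `0` as `T → ∞`. Since `f` is continuous with weak derivative `f'`, the
fundamental theorem of calculus bounds `|f|` on an interval of length `T` by the integral of `|f|/T
+ |f'|` over it. Hence on the central period the aliasing terms `f(x + kT)`, `k ≠ 0`, sum to at most
the mass `ε` of that density outside the period, and the squared error integrates to at most `ε
‖f‖₁`. Outside the period only the tail of `∫ |f|²` remains. The same bound makes the periodization
converge locally uniformly, as Poisson summation requires.

Part (i) follows from (ii): the interpolation is the Fourier transform of the estimate, so
Plancherel turns one error into `√(2π)` times the other. -/

theorem fourier_ae_eq_lpFourier {g : ℝ → ℂ} (h1 : Integrable g) (h2 : MemLp g 2) :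
    (𝓕 (h2.toLp g) : Lp ℂ 2 (volume : Measure ℝ)) =ᵐ[volume] 𝓕 g := by
  set G : Lp ℂ 2 (volume : Measure ℝ) := 𝓕 (h2.toLp g) with hG
  have hGloc : LocallyIntegrable G := (Lp.memLp G).locallyIntegrable (by norm_num)
  have hFcont : Continuous (𝓕 g) :=
    VectorFourier.fourierIntegral_continuous Real.continuous_fourierChar
      (by exact continuous_inner) h1
  have hFloc : LocallyIntegrable (𝓕 g) := hFcont.locallyIntegrable
  -- The two transforms are compared as distributions: against a test function, both move the
  -- transform onto the test function.
  refine ae_eq_of_integral_contDiff_smul_eq hGloc hFloc ?_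
  intro φ φ_smooth φ_cpt
  have hφ₁ : HasCompactSupport (Complex.ofRealCLM ∘ φ) := φ_cpt.comp_left rfl
  have hφ₂ : ContDiff ℝ ∞ (Complex.ofRealCLM ∘ φ) := by fun_prop
  set Φ : 𝓢(ℝ, ℂ) := hφ₁.toSchwartzMap hφ₂ with hΦ
  have hΦa : ∀ x, Φ x = (φ x : ℂ) := fun x => rfl
  have e1 : ∫ x, φ x • G x = ∫ x, Φ x • G x := by
    refine integral_congr_ae (Eventually.of_forall fun x => ?_)
    simp [hΦa]
  have e2 : ∫ x, φ x • 𝓕 g x = ∫ x, Φ x • 𝓕 g x := by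
    refine integral_congr_ae (Eventually.of_forall fun x => ?_)
    simp [hΦa]
  have key := DFunLike.congr_fun (Lp.fourier_toTemperedDistribution_eq (h2.toLp g)) Φ
  rw [TemperedDistribution.fourier_apply, Lp.toTemperedDistribution_apply,
    Lp.toTemperedDistribution_apply] at key
  rw [e1, e2, ← key]
  have e3 : ∫ x, (𝓕 Φ) x • (h2.toLp g) x = ∫ x, (𝓕 (Φ : ℝ → ℂ)) x • g x := by
    refine integral_congr_ae ?_
    filter_upwards [h2.coeFn_toLp] with x hx
    rw [hx, SchwartzMap.fourier_coe]
  rw [e3]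
  simpa using! (VectorFourier.integral_fourierIntegral_smul_eq_flip (L := innerₗ ℝ)
    (μ := volume) (ν := volume) Real.continuous_fourierChar (by exact continuous_inner)
    Φ.integrable h1)

theorem memLp_fourier {g : ℝ → ℂ} (h1 : Integrable g) (h2 : MemLp g 2) : MemLp (𝓕 g) 2 :=
  (Lp.memLp _).ae_eq (fourier_ae_eq_lpFourier h1 h2)

theorem eLpNorm_fourier {g : ℝ → ℂ} (h1 : Integrable g) (h2 : MemLp g 2) :
    eLpNorm (𝓕 g) 2 volume = eLpNorm g 2 volume := by
  rw [← eLpNorm_congr_ae (fourier_ae_eq_lpFourier h1 h2), ← Lp.enorm_def,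
    ← ofReal_norm, Lp.norm_fourier_eq, ofReal_norm, Lp.enorm_toLp]

theorem eLpNorm_two_comp_mul {E : Type*} [NormedAddCommGroup E] (g : ℝ → E) {a : ℝ}
    (ha : a ≠ 0) :
    eLpNorm (fun x => g (a * x)) 2 volume
      = ENNReal.ofReal |a⁻¹| ^ (1 / 2 : ℝ) * eLpNorm g 2 volume := by
  have he : MeasurableEmbedding (fun x : ℝ => a * x) :=
    (Homeomorph.mulLeft₀ a ha).measurableEmbedding
  have : eLpNorm g 2 (Measure.map (fun x => a * x) volume)
      = eLpNorm (fun x => g (a * x)) 2 volume := he.eLpNorm_map_measure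
  rw [← this, Real.map_volume_mul_left ha, eLpNorm_smul_measure_of_ne_zero]
  · simp
  · simpa using ha

theorem memLp_two_comp_mul {E : Type*} [NormedAddCommGroup E] {g : ℝ → E} (hg : MemLp g 2)
    {a : ℝ} (ha : a ≠ 0) : MemLp (fun x => g (a * x)) 2 volume := by
  have he : MeasurableEmbedding (fun x : ℝ => a * x) :=
    (Homeomorph.mulLeft₀ a ha).measurableEmbedding
  refine (he.memLp_map_measure_iff (g := g)).1 ?_
  rw [Real.map_volume_mul_left ha]
  exact hg.smul_measure ENNReal.ofReal_ne_top

/-- The kernel of `𝓕` is `e^{-2πixw}`, hence the dilation by `-1/(2π)`; in `L²` it produces the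
factor `√(2π)`. -/
theorem fourierTransform_eq_fourier (g : ℝ → ℂ) (y : ℝ) :
    fourierTransform g y = 𝓕 g ((-(2 * Real.pi)⁻¹) * y) := by
  rw [Real.fourier_real_eq_integral_exp_smul, fourierTransform]
  refine integral_congr_ae (Eventually.of_forall fun x => ?_)
  simp only [smul_eq_mul]
  congr 2
  push_cast
  have : (Real.pi : ℂ) ≠ 0 := by exact_mod_cast Real.pi_ne_zero
  field_simp

theorem memLp_fourierTransform {g : ℝ → ℂ} (h1 : Integrable g) (h2 : MemLp g 2) :
    MemLp (fourierTransform g) 2 := by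
  rw [funext (fourierTransform_eq_fourier g)]
  exact memLp_two_comp_mul (memLp_fourier h1 h2) (by simp [Real.pi_ne_zero])

theorem eLpNorm_fourierTransform {g : ℝ → ℂ} (h1 : Integrable g) (h2 : MemLp g 2) :
    eLpNorm (fourierTransform g) 2 volume
      = ENNReal.ofReal (2 * Real.pi) ^ (1 / 2 : ℝ) * eLpNorm g 2 volume := by
  rw [funext (fourierTransform_eq_fourier g),
    eLpNorm_two_comp_mul (𝓕 g) (by simp [Real.pi_ne_zero]), eLpNorm_fourier h1 h2]
  congr 3
  rw [inv_neg, inv_inv, abs_neg, abs_of_pos (by positivity)]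

theorem integrable_exp_mul {g : ℝ → ℂ} (hg : Integrable g) (y : ℝ) :
    Integrable fun x : ℝ => Complex.exp (Complex.I * (x : ℂ) * (y : ℂ)) * g x := by
  refine hg.bdd_mul (c := 1) (by fun_prop) (Eventually.of_forall fun x => ?_)
  rw [show Complex.I * (x : ℂ) * (y : ℂ) = ((x * y : ℝ) : ℂ) * Complex.I by push_cast; ring,
    Complex.norm_exp_ofReal_mul_I]

theorem fourierTransform_sub {g h : ℝ → ℂ} (hg : Integrable g) (hh : Integrable h) (y : ℝ) :
    fourierTransform (fun x => g x - h x) y = fourierTransform g y - fourierTransform h y := by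
  simp only [fourierTransform]
  rw [← integral_sub (integrable_exp_mul hg y) (integrable_exp_mul hh y)]
  simp only [mul_sub]

/-! ### The fundamental theorem of calculus for continuous functions with a weak derivative -/

theorem deriv_smoothTransition_eq_zero {x : ℝ} (hx : x ∉ Icc (0 : ℝ) 1) :
    deriv Real.smoothTransition x = 0 := by
  rcases lt_or_ge x 0 with h | h
  · have : Real.smoothTransition =ᶠ[𝓝 x] fun _ => 0 := by
      filter_upwards [Iio_mem_nhds h] with y hy
      exact Real.smoothTransition.zero_of_nonpos (le_of_lt hy)
    rw [this.deriv_eq, deriv_const]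
  · have h1 : 1 < x := by
      by_contra h'
      exact hx ⟨h, not_lt.1 h'⟩
    have : Real.smoothTransition =ᶠ[𝓝 x] fun _ => 1 := by
      filter_upwards [Ioi_mem_nhds h1] with y hy
      exact Real.smoothTransition.one_of_one_le (le_of_lt hy)
    rw [this.deriv_eq, deriv_const]

theorem differentiable_smoothTransition : Differentiable ℝ Real.smoothTransition :=
  (Real.smoothTransition.contDiff (n := 1)).differentiable (by norm_num)

theorem continuous_deriv_smoothTransition : Continuous (deriv Real.smoothTransition) :=
  (Real.smoothTransition.contDiff (n := 1)).continuous_deriv (by norm_num)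

theorem integrable_deriv_smoothTransition : Integrable (deriv Real.smoothTransition) :=
  continuous_deriv_smoothTransition.integrable_of_hasCompactSupport
    (HasCompactSupport.intro isCompact_Icc fun _ hx => deriv_smoothTransition_eq_zero hx)

theorem integral_deriv_smoothTransition : ∫ x, deriv Real.smoothTransition x = 1 := by
  have := integral_of_hasDerivAt_of_tendsto
    (fun x => (differentiable_smoothTransition x).hasDerivAt) integrable_deriv_smoothTransition
    (m := 0) (n := 1) ?_ ?_
  · simpa using this
  · refine tendsto_const_nhds.congr' ?_
    filter_upwards [eventually_le_atBot 0] with x hx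
    exact (Real.smoothTransition.zero_of_nonpos hx).symm
  · refine tendsto_const_nhds.congr' ?_
    filter_upwards [eventually_ge_atTop 1] with x hx
    exact (Real.smoothTransition.one_of_one_le hx).symm

theorem integrable_deriv_smoothTransition_mul {f : ℝ → ℂ} (hf : Continuous f) {c : ℝ}
    (hc : 0 < c) (a : ℝ) :
    Integrable fun x => ((c * deriv Real.smoothTransition (c * (x - a)) : ℝ) : ℂ) * f x := by
  refine Continuous.integrable_of_hasCompactSupport ?_
    (HasCompactSupport.intro (isCompact_Icc (a := a) (b := a + c⁻¹)) fun x hx => ?_)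
  · have := continuous_deriv_smoothTransition
    fun_prop
  · rw [deriv_smoothTransition_eq_zero]
    · simp
    · rintro ⟨h0, h1⟩
      refine hx ⟨?_, ?_⟩
      · nlinarith [nonneg_of_mul_nonneg_right h0 hc]
      · have : x - a ≤ c⁻¹ := by
          rw [← one_div, le_div_iff₀ hc]; linarith
        linarith

theorem integral_deriv_smoothTransition_mul (f : ℝ → ℂ) {c : ℝ} (hc : 0 < c) (a : ℝ) :
    ∫ x, ((c * deriv Real.smoothTransition (c * (x - a)) : ℝ) : ℂ) * f x
      = ∫ t, ((deriv Real.smoothTransition t : ℝ) : ℂ) * f (a + t / c) := by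
  have h1 := integral_sub_right_eq_self (μ := (volume : Measure ℝ))
    (fun x => ((c * deriv Real.smoothTransition (c * x) : ℝ) : ℂ) * f (a + c * x / c)) a
  have h2 := Measure.integral_comp_mul_left
    (fun t => ((c * deriv Real.smoothTransition t : ℝ) : ℂ) * f (a + t / c)) c
  rw [h2] at h1
  have h3 : ∀ x, a + c * (x - a) / c = x := fun x => by field_simp; ring
  simp only [h3] at h1
  rw [h1, ← integral_smul]
  refine integral_congr_ae (Eventually.of_forall fun t => ?_)
  simp only [abs_of_pos (inv_pos.2 hc), Complex.real_smul]
  push_cast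
  have : (c : ℂ) ≠ 0 := by exact_mod_cast hc.ne'
  field_simp

/-- The derivative of `Real.smoothTransition` has mass one and vanishes off `[0, 1]`, so its
rescalings form an approximate identity concentrating at `a` from the right. Using `n + 1` keeps the
scale at least `1`, so only values of `f` on `[a, a + 1]` matter. -/
theorem tendsto_integral_deriv_smoothTransition_mul {f : ℝ → ℂ} (hf : Continuous f) (a : ℝ) :
    Tendsto (fun n : ℕ => ∫ x,
      ((((n : ℝ) + 1) * deriv Real.smoothTransition (((n : ℝ) + 1) * (x - a)) : ℝ) : ℂ) * f x)
      atTop (𝓝 (f a)) := by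
  have hlim : ∫ t, ((deriv Real.smoothTransition t : ℝ) : ℂ) * f a = f a := by
    rw [integral_mul_const, integral_complex_ofReal, integral_deriv_smoothTransition]
    simp
  have hpos : ∀ n : ℕ, (0 : ℝ) < (n : ℝ) + 1 := fun n => by positivity
  simp only [fun n : ℕ => integral_deriv_smoothTransition_mul f (hpos n) a]
  rw [← hlim]
  obtain ⟨M, hM⟩ := isCompact_Icc.exists_bound_of_continuousOn (s := Icc a (a + 1)) hf.continuousOn
  refine tendsto_integral_of_dominated_convergence
    (fun t => ‖deriv Real.smoothTransition t‖ * M) (fun n => ?_)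
    (integrable_deriv_smoothTransition.norm.mul_const M) (fun n => ?_) ?_
  · have := continuous_deriv_smoothTransition
    exact Continuous.aestronglyMeasurable (by fun_prop)
  · refine Eventually.of_forall fun t => ?_
    rw [norm_mul, Complex.norm_real]
    by_cases ht : t ∈ Icc (0 : ℝ) 1
    · refine mul_le_mul_of_nonneg_left (hM _ ⟨?_, ?_⟩) (norm_nonneg _)
      · have := div_nonneg ht.1 (hpos n).le
        linarith
      · have : t / ((n : ℝ) + 1) ≤ 1 := by
          rw [div_le_one (hpos n)]
          have : (0 : ℝ) ≤ n := n.cast_nonneg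
          linarith [ht.2]
        linarith
    · simp [deriv_smoothTransition_eq_zero ht]
  · refine Eventually.of_forall fun t => ?_
    refine Tendsto.const_mul _ ?_
    have h0 : Tendsto (fun n : ℕ => a + t / ((n : ℝ) + 1)) atTop (𝓝 (a + 0)) :=
      tendsto_const_nhds.add (tendsto_const_nhds.div_atTop
        (tendsto_atTop_add_const_right _ _ tendsto_natCast_atTop_atTop))
    rw [add_zero] at h0
    exact (hf.tendsto a).comp h0

/-- Test the weak derivative against smooth plateaus converging pointwise to the indicator of `(a,
b]`; their derivatives converge to `δ_a - δ_b` when paired with continuous functions. -/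
theorem HasWeakDeriv.sub_eq_integral {f f' : ℝ → ℂ} (hd : HasWeakDeriv f f')
    (hf : Continuous f) (hf' : Integrable f') {a b : ℝ} (hab : a ≤ b) :
    f b - f a = ∫ x in Ioc a b, f' x := by
  set S := Real.smoothTransition with hS
  set φ : ℕ → ℝ → ℝ := fun n x => S (((n : ℝ) + 1) * (x - a)) - S (((n : ℝ) + 1) * (x - b))
    with hφ
  have hpos : ∀ n : ℕ, (0 : ℝ) < (n : ℝ) + 1 := fun n => by positivity
  have hφ_smooth : ∀ n, ContDiff ℝ ∞ (φ n) := fun n =>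
    (Real.smoothTransition.contDiff.comp (by fun_prop)).sub
      (Real.smoothTransition.contDiff.comp (by fun_prop))
  have hφ_cpt : ∀ n, HasCompactSupport (φ n) := fun n => by
    refine HasCompactSupport.intro (isCompact_Icc (a := a) (b := b + 1)) fun x hx => ?_
    rcases lt_or_ge x a with h | h
    · simp only [hφ, hS]
      rw [Real.smoothTransition.zero_of_nonpos, Real.smoothTransition.zero_of_nonpos, sub_zero]
      · exact mul_nonpos_of_nonneg_of_nonpos (hpos n).le (by linarith)
      · exact mul_nonpos_of_nonneg_of_nonpos (hpos n).le (by linarith)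
    · have h1 : b + 1 < x := by
        by_contra h'
        exact hx ⟨h, not_lt.1 h'⟩
      have hn : (0 : ℝ) ≤ n := n.cast_nonneg
      simp only [hφ, hS]
      rw [Real.smoothTransition.one_of_one_le, Real.smoothTransition.one_of_one_le, sub_self]
      · nlinarith
      · nlinarith
  have hφ_deriv : ∀ n x, deriv (φ n) x
      = ((n : ℝ) + 1) * deriv S (((n : ℝ) + 1) * (x - a))
        - ((n : ℝ) + 1) * deriv S (((n : ℝ) + 1) * (x - b)) := fun n x => by
    have h : ∀ p : ℝ, HasDerivAt (fun x => S (((n : ℝ) + 1) * (x - p)))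
        (((n : ℝ) + 1) * deriv S (((n : ℝ) + 1) * (x - p))) x := fun p => by
      have h1 : HasDerivAt (fun x : ℝ => ((n : ℝ) + 1) * (x - p)) (((n : ℝ) + 1) * 1) x :=
        ((hasDerivAt_id x).sub_const p).const_mul _
      have h2 := ((differentiable_smoothTransition (((n : ℝ) + 1) * (x - p))).hasDerivAt).comp x h1
      simpa [mul_comm] using! h2
    exact ((h a).sub (h b)).deriv
  have hleft : Tendsto (fun n : ℕ => ∫ x, ((deriv (φ n) x : ℝ) : ℂ) * f x) atTop
      (𝓝 (f a - f b)) := by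
    refine ((tendsto_integral_deriv_smoothTransition_mul hf a).sub
      (tendsto_integral_deriv_smoothTransition_mul hf b)).congr fun n => ?_
    rw [← integral_sub (integrable_deriv_smoothTransition_mul hf (hpos n) a)
      (integrable_deriv_smoothTransition_mul hf (hpos n) b)]
    refine integral_congr_ae (Eventually.of_forall fun x => ?_)
    simp only [hφ_deriv]
    push_cast
    ring
  have hright : Tendsto (fun n : ℕ => ∫ x, ((φ n x : ℝ) : ℂ) * f' x) atTop
      (𝓝 (∫ x, (Ioc a b).indicator f' x)) := by
    refine tendsto_integral_of_dominated_convergence (fun x => ‖f' x‖) (fun n => ?_) hf'.norm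
      (fun n => ?_) ?_
    · have := (hφ_smooth n).continuous
      exact (Continuous.aestronglyMeasurable (by fun_prop)).mul hf'.1
    · refine Eventually.of_forall fun x => ?_
      rw [norm_mul, Complex.norm_real]
      refine mul_le_of_le_one_left (norm_nonneg _) ?_
      have h1 : S (((n : ℝ) + 1) * (x - b)) ≤ S (((n : ℝ) + 1) * (x - a)) :=
        Real.smoothTransition.monotone (mul_le_mul_of_nonneg_left (by linarith) (hpos n).le)
      rw [Real.norm_eq_abs, abs_of_nonneg (sub_nonneg.2 h1)]
      linarith [Real.smoothTransition.le_one (((n : ℝ) + 1) * (x - a)),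
        Real.smoothTransition.nonneg (((n : ℝ) + 1) * (x - b))]
    · refine Eventually.of_forall fun x => ?_
      have hone : ∀ p : ℝ, p < x → ∀ᶠ n : ℕ in atTop, S (((n : ℝ) + 1) * (x - p)) = 1 := by
        intro p hp
        have : Tendsto (fun n : ℕ => ((n : ℝ) + 1) * (x - p)) atTop atTop :=
          (tendsto_atTop_add_const_right _ _ tendsto_natCast_atTop_atTop).atTop_mul_const
            (sub_pos.2 hp)
        filter_upwards [this.eventually_ge_atTop 1] with n hn
        exact Real.smoothTransition.one_of_one_le hn
      have hzero : ∀ p : ℝ, x ≤ p → ∀ n : ℕ, S (((n : ℝ) + 1) * (x - p)) = 0 := fun p hp n =>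
        Real.smoothTransition.zero_of_nonpos
          (mul_nonpos_of_nonneg_of_nonpos (hpos n).le (by linarith))
      refine tendsto_const_nhds.congr' ?_
      rcases le_or_gt x a with h | h
      · refine Eventually.of_forall fun n => ?_
        simp only [hφ]
        rw [hzero a h, hzero b (h.trans hab), indicator_of_notMem fun h' => not_lt.2 h h'.1]
        simp
      rcases le_or_gt x b with h' | h'
      · filter_upwards [hone a h] with n hn
        simp only [hφ]
        rw [hn, hzero b h', indicator_of_mem (show x ∈ Ioc a b from ⟨h, h'⟩)]
        simp
      · filter_upwards [hone a h, hone b h'] with n hn hn'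
        simp only [hφ]
        rw [hn, hn', indicator_of_notMem fun h'' => not_lt.2 h''.2 h']
        simp
  have heq : ∀ n, ∫ x, ((deriv (φ n) x : ℝ) : ℂ) * f x = -∫ x, ((φ n x : ℝ) : ℂ) * f' x :=
    fun n => hd.2.2 (φ n) (hφ_smooth n) (hφ_cpt n)
  have := tendsto_nhds_unique (hleft.congr heq) hright.neg
  rw [integral_indicator measurableSet_Ioc] at this
  rw [← neg_sub, this, neg_neg]

theorem HasWeakDeriv.enorm_sub_le {f f' : ℝ → ℂ} (hd : HasWeakDeriv f f')
    (hf : Continuous f) (hf' : Integrable f') {a b x y : ℝ} (hx : x ∈ Ioc a b)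
    (hy : y ∈ Ioc a b) : ‖f x - f y‖ₑ ≤ ∫⁻ t in Ioc a b, ‖f' t‖ₑ := by
  wlog hxy : y ≤ x generalizing x y
  · rw [← enorm_neg, neg_sub]
    exact this hy hx (le_of_not_ge hxy)
  rw [hd.sub_eq_integral hf hf' hxy]
  refine (enorm_integral_le_lintegral_enorm _).trans (lintegral_mono_set ?_)
  exact Ioc_subset_Ioc hy.1.le hx.2

/-- Average `|f x| ≤ |f y| + ∫ |f'|` over `y` in the interval. -/
theorem HasWeakDeriv.enorm_le_lintegral {f f' : ℝ → ℂ} (hd : HasWeakDeriv f f')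
    (hf : Continuous f) (hf' : Integrable f') {a b x : ℝ} (hx : x ∈ Ioc a b) :
    ‖f x‖ₑ ≤ ∫⁻ t in Ioc a b, (ENNReal.ofReal (b - a)⁻¹ * ‖f t‖ₑ + ‖f' t‖ₑ) := by
  have hab : 0 < b - a := by linarith [hx.1, hx.2]
  set D := ∫⁻ t in Ioc a b, ‖f' t‖ₑ with hD
  have h1 : ∀ y ∈ Ioc a b, ‖f x‖ₑ ≤ ‖f y‖ₑ + D := fun y hy => by
    calc ‖f x‖ₑ = ‖f y + (f x - f y)‖ₑ := by rw [add_sub_cancel]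
      _ ≤ ‖f y‖ₑ + ‖f x - f y‖ₑ := enorm_add_le _ _
      _ ≤ ‖f y‖ₑ + D := by gcongr; exact hd.enorm_sub_le hf hf' hx hy
  have h2 : ∫⁻ _ in Ioc a b, ‖f x‖ₑ ≤ ∫⁻ y in Ioc a b, (‖f y‖ₑ + D) :=
    setLIntegral_mono' measurableSet_Ioc h1
  have hm : Measurable fun t => ‖f t‖ₑ := hf.measurable.enorm
  rw [lintegral_add_left hm, setLIntegral_const, setLIntegral_const, Real.volume_Ioc] at h2
  rw [lintegral_add_left (hm.const_mul _), lintegral_const_mul _ hm]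
  have h3 : ENNReal.ofReal (b - a)⁻¹ * ENNReal.ofReal (b - a) = 1 := by
    rw [← ENNReal.ofReal_mul (by positivity), inv_mul_cancel₀ hab.ne', ENNReal.ofReal_one]
  calc ‖f x‖ₑ = ENNReal.ofReal (b - a)⁻¹ * (‖f x‖ₑ * ENNReal.ofReal (b - a)) := by
        rw [mul_comm ‖f x‖ₑ, ← mul_assoc, h3, one_mul]
    _ ≤ ENNReal.ofReal (b - a)⁻¹ * ((∫⁻ y in Ioc a b, ‖f y‖ₑ) + D * ENNReal.ofReal (b - a)) := by
        gcongr
    _ = _ := by rw [mul_add, mul_comm D, ← mul_assoc _ _ D, h3, one_mul]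

/-! ### Partition of the line into the translates of a period -/

/-- The translate by `k T` of the interval `(-T/2, T/2]`. -/
def cell (T : ℝ) (k : ℤ) : Set ℝ := Ioc (T * (k - 1 / 2)) (T * (k + 1 / 2))

theorem cell_eq (T : ℝ) (k : ℤ) :
    cell T k = Ioc (-(T / 2) + k • T) (-(T / 2) + (k + 1) • T) := by
  simp only [cell, zsmul_eq_mul]
  push_cast
  congr 1 <;> ring

theorem measurableSet_cell (T : ℝ) (k : ℤ) : MeasurableSet (cell T k) := measurableSet_Ioc

theorem iUnion_cell {T : ℝ} (hT : 0 < T) : ⋃ k, cell T k = univ := by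
  simp only [cell_eq]
  exact iUnion_Ioc_add_zsmul hT _

theorem pairwise_disjoint_cell (T : ℝ) : Pairwise (Function.onFun Disjoint (cell T)) := by
  simp only [funext (cell_eq T)]
  exact pairwise_disjoint_Ioc_add_zsmul _ _

theorem exists_mem_cell {T : ℝ} (hT : 0 < T) (x : ℝ) : ∃ k, x ∈ cell T k :=
  mem_iUnion.1 (iUnion_cell hT ▸ mem_univ x)

theorem tsum_setLIntegral_cell {T : ℝ} (hT : 0 < T) (u : ℝ → ℝ≥0∞) :
    ∑' k, ∫⁻ x in cell T k, u x = ∫⁻ x, u x := by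
  rw [← lintegral_iUnion (measurableSet_cell T) (pairwise_disjoint_cell T), iUnion_cell hT,
    setLIntegral_univ]

theorem add_mem_cell_iff (T x : ℝ) (k : ℤ) : x + T * k ∈ cell T k ↔ x ∈ cell T 0 := by
  simp only [cell, mem_Ioc, Int.cast_zero]
  constructor <;> rintro ⟨h1, h2⟩ <;> constructor <;> linarith

theorem setLIntegral_cell_add (T : ℝ) (k : ℤ) (u : ℝ → ℝ≥0∞) :
    ∫⁻ x in cell T 0, u (x + T * k) = ∫⁻ x in cell T k, u x := by
  rw [← lintegral_indicator (measurableSet_cell T 0), ← lintegral_indicator (measurableSet_cell T k),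
    ← lintegral_add_right_eq_self ((cell T k).indicator u) (T * k)]
  refine lintegral_congr fun x => ?_
  by_cases hx : x ∈ cell T 0
  · rw [indicator_of_mem hx, indicator_of_mem ((add_mem_cell_iff T x k).2 hx)]
  · rw [indicator_of_notMem hx, indicator_of_notMem (mt (add_mem_cell_iff T x k).1 hx)]

theorem mem_cell_zero_of_abs_le {T x : ℝ} (h : 2 * |x| < T) : x ∈ cell T 0 := by
  have := abs_lt.1 (show |x| < T / 2 by linarith)
  simp only [cell, mem_Ioc, Int.cast_zero]
  constructor <;> linarith

theorem tendsto_setLIntegral_compl_cell {u : ℝ → ℝ≥0∞} (hu : AEMeasurable u)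
    (hfin : ∫⁻ x, u x ≠ ⊤) :
    Tendsto (fun T => ∫⁻ x in (cell T 0)ᶜ, u x) atTop (𝓝 0) := by
  simp only [← lintegral_indicator (measurableSet_cell _ 0).compl]
  rw [← lintegral_zero (μ := (volume : Measure ℝ))]
  refine tendsto_lintegral_filter_of_dominated_convergence' u ?_ ?_ hfin ?_
  · exact Eventually.of_forall fun T => hu.indicator (measurableSet_cell T 0).compl
  · exact Eventually.of_forall fun T => Eventually.of_forall fun x => indicator_le_self _ _ _
  · refine Eventually.of_forall fun x => tendsto_const_nhds.congr' ?_
    filter_upwards [eventually_gt_atTop (2 * |x|)] with T hT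
    rw [indicator_of_notMem]
    exact fun h => h (mem_cell_zero_of_abs_le hT)

/-! ### Periodization -/

/-- The periodization `∑ₖ f (x + k T)` of `f`. -/
def periodization (T : ℝ) (f : ℝ → ℂ) (x : ℝ) : ℂ := ∑' k : ℤ, f (x + T * k)

/-- The density `|f| / T + |f'|`, whose integral over an interval of length `T` bounds `|f|`
there. -/
def sobolevDensity (T : ℝ) (f f' : ℝ → ℂ) (x : ℝ) : ℝ≥0∞ :=
  ENNReal.ofReal T⁻¹ * ‖f x‖ₑ + ‖f' x‖ₑ

theorem aemeasurable_sobolevDensity {T : ℝ} {f f' : ℝ → ℂ} (h1 : Integrable f)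
    (hf' : Integrable f') : AEMeasurable (sobolevDensity T f f') :=
  (h1.1.enorm.const_mul _).add hf'.1.enorm

theorem lintegral_sobolevDensity_ne_top {T : ℝ} {f f' : ℝ → ℂ} (h1 : Integrable f)
    (hf' : Integrable f') : ∫⁻ x, sobolevDensity T f f' x ≠ ⊤ := by
  simp only [sobolevDensity]
  rw [lintegral_add_left' (h1.1.enorm.const_mul _), lintegral_const_mul'' _ h1.1.enorm]
  exact ENNReal.add_ne_top.2 ⟨ENNReal.mul_ne_top ENNReal.ofReal_ne_top h1.2.ne, hf'.2.ne⟩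

section

variable {f f' : ℝ → ℂ} (hd : HasWeakDeriv f f') (hf : Continuous f) (h1 : Integrable f)
  (hf' : Integrable f') {T : ℝ} (hT : 0 < T)

include hd hf hf' in
theorem enorm_le_setLIntegral_cell {k : ℤ} {x : ℝ} (hx : x ∈ cell T k) :
    ‖f x‖ₑ ≤ ∫⁻ t in cell T k, sobolevDensity T f f' t := by
  refine (hd.enorm_le_lintegral hf hf' hx).trans (le_of_eq ?_)
  simp only [sobolevDensity, cell]
  congr! 6
  ring

include hd hf h1 hf' hT in
-- This is the local uniform summability that Poisson summation asks for, after rescaling to period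
-- `1`. The supremum over `K` of the `n`-th translate is bounded by the masses of `sobolevDensity`
-- on the boundedly many cells near the `n`-th, and these masses are summable.
theorem summable_norm_restrict_translate (K : TopologicalSpace.Compacts ℝ) :
    Summable fun n : ℤ => ‖(((⟨fun t => f (T * t), by fun_prop⟩ : C(ℝ, ℂ)).comp
      (ContinuousMap.addRight (n : ℝ))).restrict K)‖ := by
  set c : ℤ → ℝ := fun m => (∫⁻ t in cell T m, sobolevDensity T f f' t).toReal with hc
  have htop := lintegral_sobolevDensity_ne_top (T := T) h1 hf'
  have hcs : Summable c :=
    ENNReal.summable_toReal (by rw [tsum_setLIntegral_cell hT]; exact htop)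
  have hc0 : ∀ m, 0 ≤ c m := fun m => ENNReal.toReal_nonneg
  obtain ⟨M₀, hM₀⟩ := K.isCompact.isBounded.exists_norm_le
  -- If `T (x + n)` lies in cell `m` and `|x| ≤ M₀`, then `|m - n| ≤ M₀ + 1/2 < M`.
  obtain ⟨M, hM⟩ := exists_nat_gt (M₀ + 1)
  refine Summable.of_nonneg_of_le (fun _ => norm_nonneg _) (fun n => ?_)
    (summable_sum (s := Finset.Icc (-(M : ℤ)) M) fun j _ =>
      ((Equiv.addRight j).summable_iff (f := c)).2 hcs)
  refine (ContinuousMap.norm_le _ (Finset.sum_nonneg fun _ _ => hc0 _)).2 fun x => ?_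
  obtain ⟨m, hm⟩ := exists_mem_cell hT (T * ((x : ℝ) + n))
  have hmb : m - 1 / 2 < (x : ℝ) + n ∧ (x : ℝ) + n ≤ m + 1 / 2 :=
    ⟨lt_of_mul_lt_mul_left hm.1 hT.le, le_of_mul_le_mul_left hm.2 hT⟩
  have hx := abs_le.1 (hM₀ x x.2)
  have hj : m - n ∈ Finset.Icc (-(M : ℤ)) M := by
    rw [Finset.mem_Icc]
    constructor
    · have : (-(M : ℝ)) < m - n := by linarith [hmb.1, hmb.2, hx.1, hx.2]
      exact_mod_cast this.le
    · have : ((m : ℝ) - n) < M := by linarith [hmb.1, hmb.2, hx.1, hx.2]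
      exact_mod_cast this.le
  have hle : ‖f (T * ((x : ℝ) + n))‖ ≤ c m := by
    have := enorm_le_setLIntegral_cell hd hf hf' hm
    rw [← toReal_enorm]
    refine ENNReal.toReal_mono (ne_top_of_le_ne_top htop ?_) this
    exact setLIntegral_le_lintegral _ _
  refine (hle.trans (le_of_eq ?_)).trans
    (Finset.single_le_sum (f := fun j => c (n + j)) (fun _ _ => hc0 _) hj)
  simp

include hd hf h1 hf' hT in
theorem exists_periodization_lift : ∃ P : C(UnitAddCircle, ℂ),
    (∀ t : ℝ, P (t : UnitAddCircle) = periodization T f (T * t)) ∧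
    (∀ t : ℝ, Summable fun k : ℤ => f (t + T * k)) ∧
    ∀ n : ℤ, fourierCoeff P n = 𝓕 (fun t => f (T * t)) (n : ℝ) := by
  set g : C(ℝ, ℂ) := ⟨fun t => f (T * t), by fun_prop⟩ with hg
  have hs := summable_norm_restrict_translate hd hf h1 hf' hT
  have hsum : ∀ t : ℝ, HasSum (fun n : ℤ => f (T * t + T * n))
      ((∑' n : ℤ, g.comp (ContinuousMap.addRight (n : ℝ))) t) := fun t => by
    have := ContinuousMap.hasSum_apply
      (ContinuousMap.summable_of_locally_summable_norm hs).hasSum t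
    simpa [mul_add] using! this
  refine ⟨⟨(g.periodic_tsum_comp_add_zsmul 1).lift,
    continuous_coinduced_dom.mpr (map_continuous _)⟩, fun t => ?_, fun t => ?_, fun n => ?_⟩
  · rw [periodization, (hsum t).tsum_eq]
    simp only [ContinuousMap.coe_mk, Function.Periodic.lift_coe, zsmul_one]
  · have := (hsum (T⁻¹ * t)).summable
    rwa [mul_inv_cancel_left₀ hT.ne'] at this
  · exact Real.fourierCoeff_tsum_comp_add hs n

include hd hf h1 hf' hT in
/-- On the central cell, the square of the periodization error is controlled by the mass of
`|f| / T + |f'|` outside that cell. -/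
theorem setLIntegral_enorm_sub_periodization_sq_le :
    ∫⁻ x in cell T 0, ‖f x - periodization T f x‖ₑ ^ (2 : ℝ)
      ≤ (∫⁻ x in (cell T 0)ᶜ, sobolevDensity T f f' x) * ∫⁻ x, ‖f x‖ₑ := by
  obtain ⟨-, -, hsum, -⟩ := exists_periodization_lift hd hf h1 hf' hT
  set ε := ∫⁻ x in (cell T 0)ᶜ, sobolevDensity T f f' x with hε
  set w : ℤ → ℝ → ℝ≥0∞ := fun k x => if k = 0 then 0 else ‖f (x + T * k)‖ₑ with hw
  have hwm : ∀ k, Measurable (w k) := fun k => by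
    by_cases hk : k = 0
    · simp [hw, hk]
    · simp only [hw, hk, if_false]
      exact (hf.comp (by fun_prop)).measurable.enorm
  have hle : ∀ x, ‖f x - periodization T f x‖ₑ ≤ ∑' k, w k x := fun x => by
    rw [periodization, (hsum x).tsum_eq_add_tsum_ite 0]
    simp only [Int.cast_zero, mul_zero, add_zero]
    rw [sub_add_cancel_left, enorm_neg]
    refine (enorm_tsum_le_tsum_enorm).trans (ENNReal.tsum_le_tsum fun k => ?_)
    by_cases hk : k = 0 <;> simp [hw, hk]
  -- The term of index `k ≠ 0` is at most the mass of the density on cell `k`, and these cells lie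
  -- in the complement of the central one.
  have hsup : ∀ x ∈ cell T 0, ∑' k, w k x ≤ ε := fun x hx => by
    rw [hε, ← lintegral_indicator (measurableSet_cell T 0).compl, ← tsum_setLIntegral_cell hT]
    refine ENNReal.tsum_le_tsum fun k => ?_
    by_cases hk : k = 0
    · simp [hw, hk]
    · simp only [hw, hk, if_false]
      refine (enorm_le_setLIntegral_cell hd hf hf' ((add_mem_cell_iff T x k).2 hx)).trans ?_
      refine setLIntegral_mono_ae' (measurableSet_cell T k) (Eventually.of_forall fun y hy => ?_)
      rw [indicator_of_mem]
      exact fun hy0 => disjoint_left.1 (pairwise_disjoint_cell T hk) hy hy0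
  calc ∫⁻ x in cell T 0, ‖f x - periodization T f x‖ₑ ^ (2 : ℝ)
      ≤ ∫⁻ x in cell T 0, ε * ∑' k, w k x := by
        refine setLIntegral_mono_ae' (measurableSet_cell T 0)
          (Eventually.of_forall fun x hx => ?_)
        -- One factor of the square is bounded uniformly by `ε`; the other is kept, and integrates
        -- to at most `‖f‖₁` by unfolding.
        rw [ENNReal.rpow_two, sq]
        exact mul_le_mul' ((hle x).trans (hsup x hx)) (hle x)
    _ = ε * ∑' k, ∫⁻ x in cell T 0, w k x := by
        rw [lintegral_const_mul _ (Measurable.tsum hwm),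
          lintegral_tsum fun k => (hwm k).aemeasurable]
    _ ≤ ε * ∑' k : ℤ, ∫⁻ x in cell T 0, ‖f (x + T * k)‖ₑ := by
        gcongr with k x
        by_cases hk : k = 0 <;> simp [hw, hk]
    _ = ε * ∫⁻ x, ‖f x‖ₑ := by
        simp only [fun k => setLIntegral_cell_add T k fun x => ‖f x‖ₑ]
        rw [tsum_setLIntegral_cell hT]

/-- The periodization of `f`, cut off outside the central cell. -/
def truncatedPeriodization (T : ℝ) (f : ℝ → ℂ) : ℝ → ℂ :=
  (cell T 0).indicator (periodization T f)

include hd hf h1 hf' hT in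
theorem lintegral_enorm_sub_truncatedPeriodization_sq_le :
    ∫⁻ x, ‖f x - truncatedPeriodization T f x‖ₑ ^ (2 : ℝ)
      ≤ (∫⁻ x in (cell T 0)ᶜ, sobolevDensity T f f' x) * (∫⁻ x, ‖f x‖ₑ)
        + ∫⁻ x in (cell T 0)ᶜ, ‖f x‖ₑ ^ (2 : ℝ) := by
  rw [← lintegral_add_compl _ (measurableSet_cell T 0)]
  refine add_le_add ((le_of_eq ?_).trans
    (setLIntegral_enorm_sub_periodization_sq_le hd hf h1 hf' hT)) (le_of_eq ?_)
  · refine setLIntegral_congr_fun (measurableSet_cell T 0) fun x hx => ?_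
    simp only [truncatedPeriodization, indicator_of_mem hx]
  · refine setLIntegral_congr_fun (measurableSet_cell T 0).compl fun x hx => ?_
    simp only [truncatedPeriodization, indicator_of_notMem hx, sub_zero]

include hd hf h1 hf' in
theorem tendsto_eLpNorm_sub_truncatedPeriodization (h2 : MemLp f 2) :
    Tendsto (fun T => eLpNorm (fun x => f x - truncatedPeriodization T f x) 2 volume) atTop
      (𝓝 0) := by
  have hA : ∫⁻ x, ‖f x‖ₑ ≠ ⊤ := h1.2.ne
  have hB : ∫⁻ x, ‖f x‖ₑ ^ (2 : ℝ) ≠ ⊤ := by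
    have := lintegral_rpow_enorm_lt_top_of_eLpNorm_lt_top (p := 2) (by norm_num) (by norm_num) h2.2
    simpa using this.ne
  -- The density itself depends on `T`; for `T ≥ 1` it is dominated by the one with `T = 1`, leaving
  -- the tail of a fixed integrable function.
  have t1 : Tendsto (fun T => ∫⁻ x in (cell T 0)ᶜ, sobolevDensity T f f' x) atTop (𝓝 0) := by
    refine tendsto_of_tendsto_of_tendsto_of_le_of_le' tendsto_const_nhds
      (tendsto_setLIntegral_compl_cell (aemeasurable_sobolevDensity (T := 1) h1 hf')
        (lintegral_sobolevDensity_ne_top h1 hf'))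
      (Eventually.of_forall fun _ => zero_le) ?_
    filter_upwards [eventually_ge_atTop 1] with T hT
    refine lintegral_mono fun x => ?_
    simp only [sobolevDensity]
    gcongr
  have t2 := tendsto_setLIntegral_compl_cell (hf.measurable.enorm.pow_const (2 : ℝ)).aemeasurable hB
  have t3 : Tendsto (fun T => ((∫⁻ x in (cell T 0)ᶜ, sobolevDensity T f f' x) * (∫⁻ x, ‖f x‖ₑ)
        + ∫⁻ x in (cell T 0)ᶜ, ‖f x‖ₑ ^ (2 : ℝ)) ^ (1 / 2 : ℝ)) atTop (𝓝 0) := by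
    have := ((ENNReal.Tendsto.mul_const t1 (Or.inr hA)).add t2).ennrpow_const (1 / 2 : ℝ)
    simpa using this
  refine tendsto_of_tendsto_of_tendsto_of_le_of_le' tendsto_const_nhds t3
      (Eventually.of_forall fun _ => zero_le) ?_
  filter_upwards [eventually_gt_atTop 0] with T hT
  rw [eLpNorm_eq_lintegral_rpow_enorm_toReal (by norm_num) (by norm_num)]
  simp only [ENNReal.toReal_ofNat]
  exact ENNReal.rpow_le_rpow
    (lintegral_enorm_sub_truncatedPeriodization_sq_le hd hf h1 hf' hT) (by norm_num)

end

/-! ### The estimate as a truncated trigonometric polynomial -/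

/-- The two sides differ only at `±T/2`, where `rect` is `1/2` and the cell is half-open. -/
theorem rect_div_ae_eq {T : ℝ} (hT : 0 < T) :
    (fun x => rect (x / T)) =ᵐ[volume] (cell T 0).indicator fun _ => (1 : ℝ) := by
  filter_upwards [measure_eq_zero_iff_ae_notMem.1 (measure_singleton (μ := volume) (T / 2)),
    measure_eq_zero_iff_ae_notMem.1 (measure_singleton (μ := volume) (-(T / 2)))] with x hx hx'
  rw [mem_singleton_iff] at hx hx'
  have habs : |x / T| = |x| / T := by rw [abs_div, abs_of_pos hT]
  have hne : |x| ≠ T / 2 := fun h => by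
    rcases abs_choice x with h' | h'
    · exact hx (h' ▸ h)
    · exact hx' (by linarith)
  rcases lt_or_gt_of_ne hne with h | h
  · have h' : |x / T| < 1 / 2 := by rw [habs, div_lt_iff₀ hT]; linarith
    rw [indicator_of_mem (mem_cell_zero_of_abs_le (by linarith)), rect, if_pos h']
  · have h' : 1 / 2 < |x / T| := by rw [habs, lt_div_iff₀ hT]; linarith
    rw [indicator_of_notMem, rect, if_neg (not_lt.2 h'.le), if_neg h'.ne']
    intro hm
    simp only [cell, mem_Ioc, Int.cast_zero] at hm
    exact not_le.2 h (abs_le.2 ⟨by linarith [hm.1], by linarith [hm.2]⟩)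

/-- The trigonometric polynomial whose restriction to the central cell is the estimate of `f`. -/
def estimatePoly (f : ℝ → ℂ) (R : ℝ) (N : ℕ) (x : ℝ) : ℂ :=
  ((R / (2 * Real.pi * (N : ℝ)) : ℝ) : ℂ) * ∑ n ∈ Finset.Icc (-(N : ℤ)) (N : ℤ),
    fourierTransform f ((n : ℝ) * (R / (N : ℝ))) *
      Complex.exp (-(Complex.I * ((x * ((n : ℝ) * (R / (N : ℝ))) : ℝ) : ℂ)))

theorem continuous_estimatePoly (f : ℝ → ℂ) (R : ℝ) (N : ℕ) :
    Continuous (estimatePoly f R N) := by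
  unfold estimatePoly
  fun_prop

theorem estimate_ae_eq (f : ℝ → ℂ) {R : ℝ} {N : ℕ} (hR : 0 < R) (hN : 1 ≤ N) :
    estimate f R N =ᵐ[volume]
      (cell (2 * Real.pi * N / R) 0).indicator (estimatePoly f R N) := by
  have hN' : (0 : ℝ) < N := by exact_mod_cast hN
  have hT : 0 < 2 * Real.pi * N / R := by positivity
  filter_upwards [rect_div_ae_eq hT] with x hx
  have harg : x * R / (2 * Real.pi * (N : ℝ)) = x / (2 * Real.pi * N / R) := by
    field_simp
  rw [estimate, harg, hx]
  by_cases hm : x ∈ cell (2 * Real.pi * N / R) 0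
  · rw [indicator_of_mem hm, indicator_of_mem hm, mul_one, estimatePoly]
  · rw [indicator_of_notMem hm, indicator_of_notMem hm]
    simp

theorem memLp_indicator_cell {h : ℝ → ℂ} (hh : Continuous h) (T : ℝ) (p : ℝ≥0∞) :
    MemLp ((cell T 0).indicator h) p := by
  rw [memLp_indicator_iff_restrict (measurableSet_cell T 0)]
  obtain ⟨C, hC⟩ := isCompact_Icc.exists_bound_of_continuousOn
    (s := Icc (T * ((0 : ℤ) - 1 / 2)) (T * ((0 : ℤ) + 1 / 2))) hh.continuousOn
  have : IsFiniteMeasure (volume.restrict (cell T 0)) := by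
    unfold cell
    infer_instance
  exact MemLp.of_bound hh.aestronglyMeasurable C
    ((ae_restrict_mem (measurableSet_cell T 0)).mono fun x hx => hC x (Ioc_subset_Icc_self hx))

theorem memLp_estimate (f : ℝ → ℂ) {R : ℝ} {N : ℕ} (hR : 0 < R) (hN : 1 ≤ N) (p : ℝ≥0∞) :
    MemLp (estimate f R N) p :=
  (memLp_indicator_cell (continuous_estimatePoly f R N) _ p).ae_eq (estimate_ae_eq f hR hN).symm

theorem integrable_estimate (f : ℝ → ℂ) {R : ℝ} {N : ℕ} (hR : 0 < R) (hN : 1 ≤ N) :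
    Integrable (estimate f R N) :=
  memLp_one_iff_integrable.1 (memLp_estimate f hR hN 1)

/-! ### The band-limited interpolation is the Fourier transform of the estimate -/

theorem integral_cell_exp {T : ℝ} (hT : 0 < T) (s : ℝ) :
    ∫ x in cell T 0, Complex.exp (Complex.I * (x : ℂ) * (s : ℂ))
      = T * ((nsinc (T * s / (2 * Real.pi)) : ℝ) : ℂ) := by
  have hab : T * ((0 : ℤ) - 1 / 2) ≤ T * ((0 : ℤ) + 1 / 2) := by
    gcongr; norm_num
  rw [cell, ← intervalIntegral.integral_of_le hab]
  rcases eq_or_ne s 0 with rfl | hs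
  · simp [nsinc]
    norm_num
    ring
  · have hs' : (s : ℂ) ≠ 0 := by exact_mod_cast hs
    have hT' : (T : ℂ) ≠ 0 := by exact_mod_cast hT.ne'
    have hpi : (Real.pi : ℂ) ≠ 0 := by exact_mod_cast Real.pi_ne_zero
    have hc : Complex.I * (s : ℂ) ≠ 0 := mul_ne_zero Complex.I_ne_zero hs'
    have hne : T * s / (2 * Real.pi) ≠ 0 := by
      have := Real.pi_ne_zero
      positivity
    have h := integral_exp_mul_complex (a := T * ((0 : ℤ) - 1 / 2)) (b := T * ((0 : ℤ) + 1 / 2)) hc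
    have hcomm : ∀ x : ℝ, Complex.I * (x : ℂ) * (s : ℂ) = Complex.I * (s : ℂ) * x := fun x => by
      ring
    simp only [hcomm]
    rw [h, nsinc, if_neg hne]
    have harg : Real.pi * (T * s / (2 * Real.pi)) = T * s / 2 := by
      have := Real.pi_ne_zero
      field_simp
    rw [harg]
    push_cast
    rw [Complex.sin]
    have e1 : Complex.I * (s : ℂ) * ((T : ℂ) * (0 + 1 / 2)) = (T : ℂ) * s / 2 * Complex.I := by
      ring
    have e2 : Complex.I * (s : ℂ) * ((T : ℂ) * (0 - 1 / 2)) = -((T : ℂ) * s / 2) * Complex.I := by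
      ring
    rw [e1, e2]
    field_simp
    rw [Complex.I_sq]
    ring

/-- Each exponential cut off to the central cell transforms into a shifted cardinal sine, whose
height `T` cancels the prefactor `R/(2πN) = T⁻¹`. -/
theorem fourierTransform_estimate (f : ℝ → ℂ) {R : ℝ} {N : ℕ} (hR : 0 < R) (hN : 1 ≤ N)
    (y : ℝ) : fourierTransform (estimate f R N) y = bandlimitedInterp f R N y := by
  have hN' : (0 : ℝ) < N := by exact_mod_cast hN
  have hpi := Real.pi_pos
  set T := 2 * Real.pi * N / R with hTdef
  have hT : 0 < T := by positivity
  have hTinv : R / (2 * Real.pi * N) = T⁻¹ := by rw [hTdef, inv_div]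
  have e1 : fourierTransform (estimate f R N) y
      = ∫ x in cell T 0, Complex.exp (Complex.I * (x : ℂ) * (y : ℂ)) * estimatePoly f R N x := by
    rw [fourierTransform, ← integral_indicator (measurableSet_cell T 0)]
    refine integral_congr_ae ?_
    filter_upwards [estimate_ae_eq f hR hN] with x hx
    rw [hx, ← hTdef]
    by_cases hm : x ∈ cell T 0
    · rw [indicator_of_mem hm, indicator_of_mem hm]
    · rw [indicator_of_notMem hm, indicator_of_notMem hm, mul_zero]
  have e2 : ∀ x : ℝ, Complex.exp (Complex.I * (x : ℂ) * (y : ℂ)) * estimatePoly f R N x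
      = ∑ n ∈ Finset.Icc (-(N : ℤ)) (N : ℤ),
        ((T⁻¹ : ℝ) : ℂ) * fourierTransform f ((n : ℝ) * (R / (N : ℝ))) *
          Complex.exp (Complex.I * (x : ℂ) * ((y - n * (R / N) : ℝ) : ℂ)) := fun x => by
    rw [estimatePoly, hTinv, Finset.mul_sum, Finset.mul_sum]
    refine Finset.sum_congr rfl fun n _ => ?_
    have : Complex.I * (x : ℂ) * ((y - n * (R / N) : ℝ) : ℂ) = Complex.I * (x : ℂ) * (y : ℂ)
        + -(Complex.I * ((x * ((n : ℝ) * (R / (N : ℝ))) : ℝ) : ℂ)) := by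
      push_cast
      ring
    rw [this, Complex.exp_add]
    ring
  rw [e1]
  simp only [e2]
  rw [integral_finsetSum]
  · refine Finset.sum_congr rfl fun n _ => ?_
    rw [integral_const_mul, integral_cell_exp hT]
    have harg : T * (y - n * (R / N)) / (2 * Real.pi) = N / R * y - n := by
      rw [hTdef]
      field_simp
    rw [harg]
    have hT' : (T : ℂ) ≠ 0 := by exact_mod_cast hT.ne'
    push_cast
    field_simp
  · intro n _
    refine Integrable.const_mul ?_ _
    exact (Continuous.integrableOn_Icc (by fun_prop)).mono_set Ioc_subset_Icc_self

/-! ### Convergence of the estimates to the truncated periodization -/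

theorem fourier_comp_mul (f : ℝ → ℂ) {T : ℝ} (hT : 0 < T) (w : ℝ) :
    𝓕 (fun t => f (T * t)) w = ((T⁻¹ : ℝ) : ℂ) * 𝓕 f (w / T) := by
  rw [Real.fourier_real_eq_integral_exp_smul, Real.fourier_real_eq_integral_exp_smul]
  have := Measure.integral_comp_mul_left
    (fun v : ℝ => Complex.exp (((-2 * Real.pi * v * (w / T) : ℝ) : ℂ) * Complex.I) • f v) T
  rw [abs_of_pos (inv_pos.2 hT), Complex.real_smul] at this
  rw [← this]
  refine integral_congr_ae (Eventually.of_forall fun x => ?_)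
  have h : -2 * Real.pi * (T * x) * (w / T) = -2 * Real.pi * x * w := by field_simp
  simp only [h]

theorem estimatePoly_eq_sum_fourier (f : ℝ → ℂ) {B : ℝ} (hB : 0 < B) {N : ℕ} (hN : 1 ≤ N)
    (x : ℝ) :
    estimatePoly f ((N : ℝ) / (2 * B)) N x
      = ∑ n ∈ Finset.Icc (-(N : ℤ)) (N : ℤ),
        𝓕 (fun t => f (4 * Real.pi * B * t)) (n : ℝ)
          * fourier n ((x / (4 * Real.pi * B) : ℝ) : UnitAddCircle) := by
  have hN' : (0 : ℝ) < N := by exact_mod_cast hN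
  have hpi := Real.pi_pos
  have hT : 0 < 4 * Real.pi * B := by positivity
  rw [estimatePoly, Finset.mul_sum]
  -- The reflection reconciles the opposite signs in the exponents of `fourierTransform` and `𝓕`.
  refine Finset.sum_equiv (Equiv.neg ℤ) (fun n => ?_) fun n _ => ?_
  · simp only [Finset.mem_Icc, Equiv.neg_apply]
    omega
  · rw [fourier_comp_mul f hT, fourierTransform_eq_fourier, fourier_coe_apply, ← mul_assoc]
    congr 1
    · congr 1
      · congr 1
        field_simp
        norm_num
      · have hNB : (n : ℝ) * ((N : ℝ) / (2 * B) / N) = n / (2 * B) := by field_simp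
        rw [hNB, Equiv.neg_apply]
        push_cast
        field_simp
        norm_num [mul_comm, mul_assoc, mul_left_comm]
    · congr 1
      simp only [Equiv.neg_apply]
      have hp : (Real.pi : ℂ) ≠ 0 := by exact_mod_cast hpi.ne'
      have hb : (B : ℂ) ≠ 0 := by exact_mod_cast hB.ne'
      have hn : (N : ℂ) ≠ 0 := by exact_mod_cast hN'.ne'
      push_cast
      field_simp
      norm_num

theorem tendsto_eLpNorm_fourier_partialSum_sub (P : C(UnitAddCircle, ℂ)) :
    Tendsto (fun N : ℕ => eLpNorm (fun t : UnitAddCircle =>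
      (∑ n ∈ Finset.Icc (-(N : ℤ)) (N : ℤ), fourierCoeff P n * fourier n t) - P t) 2 volume)
      atTop (𝓝 0) := by
  have hvol : (volume : Measure UnitAddCircle) = AddCircle.haarAddCircle := by
    rw [AddCircle.volume_eq_smul_haarAddCircle, ENNReal.ofReal_one, one_smul]
  rw [hvol]
  have h := hasSum_fourier_series_L2
    (ContinuousMap.toLp (E := ℂ) 2 (AddCircle.haarAddCircle (T := 1)) ℂ P)
  simp only [fourierCoeff_toLp] at h
  -- The Fourier series converges unconditionally in `L²`, in particular along symmetric intervals.
  have h' := h.comp (Finset.tendsto_Icc_neg (R := ℤ))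
  rw [Lp.tendsto_Lp_iff_tendsto_eLpNorm'] at h'
  refine h'.congr fun N => eLpNorm_congr_ae ?_
  set S : C(UnitAddCircle, ℂ) :=
    ∑ n ∈ Finset.Icc (-(N : ℤ)) (N : ℤ), fourierCoeff P n • fourier n with hS
  have hsum : ∑ n ∈ Finset.Icc (-(N : ℤ)) (N : ℤ),
      fourierCoeff P n • fourierLp (T := 1) 2 n
        = ContinuousMap.toLp (E := ℂ) 2 (AddCircle.haarAddCircle (T := 1)) ℂ S := by
    rw [hS, map_sum]
    simp only [map_smul]
  simp only [Function.comp_apply]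
  rw [hsum]
  filter_upwards [ContinuousMap.coeFn_toLp (p := 2) (𝕜 := ℂ)
    (AddCircle.haarAddCircle (T := 1)) S, ContinuousMap.coeFn_toLp (p := 2) (𝕜 := ℂ)
    (AddCircle.haarAddCircle (T := 1)) P] with t h1 h2
  rw [Pi.sub_apply, h1, h2, hS, ContinuousMap.sum_apply]
  simp

theorem eLpNorm_indicator_cell_comp {T : ℝ} (hT : 0 < T) {H : UnitAddCircle → ℂ}
    (hH : Continuous H) :
    eLpNorm ((cell T 0).indicator fun x => H ((x / T : ℝ) : UnitAddCircle)) 2 volume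
      = ENNReal.ofReal T ^ (1 / 2 : ℝ) * eLpNorm H 2 volume := by
  have hT' : T⁻¹ ≠ 0 := inv_ne_zero hT.ne'
  set I := Ioc (-(1 / 2 : ℝ)) (-(1 / 2) + 1) with hI
  have e1 : ((cell T 0).indicator fun x => H ((x / T : ℝ) : UnitAddCircle))
      = fun x => I.indicator (fun t : ℝ => H (t : UnitAddCircle)) (T⁻¹ * x) := by
    ext x
    have hiff : x ∈ cell T 0 ↔ T⁻¹ * x ∈ I := by
      rw [inv_mul_eq_div]
      simp only [cell, hI, mem_Ioc, lt_div_iff₀ hT, div_le_iff₀ hT, Int.cast_zero]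
      constructor <;> rintro ⟨h1, h2⟩ <;> constructor <;> linarith
    by_cases hx : x ∈ cell T 0
    · rw [indicator_of_mem hx, indicator_of_mem (hiff.1 hx), inv_mul_eq_div]
    · rw [indicator_of_notMem hx, indicator_of_notMem (mt hiff.2 hx)]
  rw [e1, eLpNorm_two_comp_mul _ hT', inv_inv, abs_of_pos hT,
    eLpNorm_indicator_eq_eLpNorm_restrict measurableSet_Ioc]
  congr 1
  exact eLpNorm_comp_measurePreserving (hH.aestronglyMeasurable)
    (UnitAddCircle.measurePreserving_mk (-(1 / 2)))

section

variable {f f' : ℝ → ℂ} (hd : HasWeakDeriv f f') (hf : Continuous f) (h1 : Integrable f)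
  (hf' : Integrable f')

include hd hf h1 hf' in
-- For `N ≥ 1` the norm is exactly `√T` times the `L²` error of a Fourier partial sum on the unit
-- circle.
theorem tendsto_eLpNorm_estimate_sub {B : ℝ} (hB : 0 < B) :
    Tendsto (fun N : ℕ => eLpNorm (fun x => estimate f ((N : ℝ) / (2 * B)) N x
      - truncatedPeriodization (4 * Real.pi * B) f x) 2 volume) atTop (𝓝 0) := by
  have hpi := Real.pi_pos
  set T := 4 * Real.pi * B with hTdef
  have hT : 0 < T := by positivity
  obtain ⟨P, hP, -, hPc⟩ := exists_periodization_lift hd hf h1 hf' hT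
  have key := ENNReal.Tendsto.const_mul (a := ENNReal.ofReal T ^ (1 / 2 : ℝ))
    (tendsto_eLpNorm_fourier_partialSum_sub P)
    (Or.inr (ENNReal.rpow_ne_top_of_nonneg (by norm_num) ENNReal.ofReal_ne_top))
  rw [mul_zero] at key
  refine key.congr' ?_
  filter_upwards [eventually_ge_atTop 1] with N hN
  have hN' : (0 : ℝ) < N := by exact_mod_cast hN
  have hR : 0 < (N : ℝ) / (2 * B) := by positivity
  have hTR : 2 * Real.pi * N / ((N : ℝ) / (2 * B)) = T := by
    rw [hTdef]
    field_simp
    norm_num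
  rw [← eLpNorm_indicator_cell_comp hT (by fun_prop)]
  refine eLpNorm_congr_ae ?_
  filter_upwards [estimate_ae_eq f hR hN] with x hx
  rw [hx, hTR, truncatedPeriodization]
  by_cases hm : x ∈ cell T 0
  · rw [indicator_of_mem hm, indicator_of_mem hm, indicator_of_mem hm,
      estimatePoly_eq_sum_fourier f hB hN, hP, mul_div_cancel₀ _ hT.ne']
    simp only [hPc, ← hTdef]
  · rw [indicator_of_notMem hm, indicator_of_notMem hm, indicator_of_notMem hm, sub_zero]

include hd hf h1 hf' in
theorem memLp_truncatedPeriodization {T : ℝ} (hT : 0 < T) :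
    MemLp (truncatedPeriodization T f) 2 := by
  obtain ⟨P, hP, -, -⟩ := exists_periodization_lift hd hf h1 hf' hT
  have : periodization T f = fun x => P ((x / T : ℝ) : UnitAddCircle) := by
    ext x
    rw [hP, mul_div_cancel₀ _ hT.ne']
  rw [truncatedPeriodization, this]
  refine memLp_indicator_cell ?_ T 2
  exact P.continuous.comp (continuous_quotient_mk'.comp (continuous_id.div_const T))

include hd hf h1 hf' in
-- The triangle inequality squeezes the norm between `L - t` and `L + t`, where `t → 0` is the
-- distance from the estimate to the truncated periodization; finiteness of `L` makes the
-- subtraction in `ℝ≥0∞` continuous.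
theorem tendsto_eLpNorm_sub_estimate (h2 : MemLp f 2) {B : ℝ} (hB : 0 < B) :
    Tendsto (fun N : ℕ => eLpNorm (fun x => f x - estimate f ((N : ℝ) / (2 * B)) N x) 2 volume)
      atTop (𝓝 (eLpNorm (fun x => f x - truncatedPeriodization (4 * Real.pi * B) f x) 2
        volume)) := by
  have hT : 0 < 4 * Real.pi * B := by
    have := Real.pi_pos
    positivity
  set Q := truncatedPeriodization (4 * Real.pi * B) f with hQ
  have hQ2 : MemLp Q 2 := memLp_truncatedPeriodization hd hf h1 hf' hT
  have t := tendsto_eLpNorm_estimate_sub hd hf h1 hf' hB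
  set L := eLpNorm (fun x => f x - Q x) 2 volume with hL
  have hLtop : L ≠ ⊤ := (h2.sub hQ2).2.ne
  have tl := ENNReal.Tendsto.sub (tendsto_const_nhds (x := L)) t (Or.inl hLtop)
  have tu := (tendsto_const_nhds (x := L)).add t
  rw [tsub_zero] at tl
  rw [add_zero] at tu
  have hmem : ∀ᶠ N : ℕ in atTop, MemLp (estimate f ((N : ℝ) / (2 * B)) N) 2 := by
    filter_upwards [eventually_ge_atTop 1] with N hN
    have hN' : (0 : ℝ) < N := by exact_mod_cast hN
    exact memLp_estimate f (by positivity) hN 2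
  refine tendsto_of_tendsto_of_tendsto_of_le_of_le' tl tu ?_ ?_
  · filter_upwards [hmem] with N hN
    rw [tsub_le_iff_right, hL]
    refine le_trans (le_of_eq ?_) (eLpNorm_add_le (h2.sub hN).1 (hN.sub hQ2).1 (by norm_num))
    congr 1
    ext x
    simp [hQ]
  · filter_upwards [hmem] with N hN
    rw [hL]
    refine le_trans (le_of_eq ?_) (((eLpNorm_sub_le (h2.sub hQ2).1 (hN.sub hQ2).1 (by norm_num))))
    congr 1
    ext x
    simp [hQ]

end

/-! ### Integrability on the whole line and the iterated limits -/

theorem integrable_of_even {f : ℝ → ℂ} (he : Function.Even f)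
    (hi : IntegrableOn f (Ioi 0) volume) : Integrable f := by
  have h : IntegrableOn f (Iio 0) volume := by
    have := hi.comp_neg
    simpa [he _] using this
  rw [← integrableOn_univ, ← Iic_union_Ioi (a := (0 : ℝ))]
  exact (integrableOn_Iic_iff_integrableOn_Iio (by simp) |>.2 h).union hi

theorem IteratedLimitZero.of_tendsto {a : ℝ → ℕ → ℝ≥0∞} {l : ℝ → ℝ≥0∞}
    (hl : ∀ B, 0 < B → l B ≠ ⊤) (ha : ∀ B, 0 < B → Tendsto (a B) atTop (𝓝 (l B)))
    (h0 : Tendsto l atTop (𝓝 0)) : IteratedLimitZero a := by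
  refine ⟨fun B => (l B).toNNReal, fun B hB => ?_, ?_⟩
  · rw [ENNReal.coe_toNNReal (hl B hB)]
    exact ha B hB
  · exact (ENNReal.tendsto_toNNReal ENNReal.zero_ne_top).comp h0

end AlphaSine

end

theorem mainTheorem4 (α : ℝ) (hα : -1 < α) (f : ℝ → ℂ)
    (hf1 : AlphaSine.MemL1EvenWeighted α f) (hf2 : MemLp f 2 volume) (hcont : Continuous f)
    (hderiv : ∃ f' : ℝ → ℂ, Integrable f' volume ∧ AlphaSine.HasWeakDeriv f f') :
    (MemLp (AlphaSine.fourierTransform f) 2 volume ∧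
      (∀ (R : ℝ) (N : ℕ), 0 < R → 1 ≤ N →
        MemLp (AlphaSine.bandlimitedInterp f R N) 2 volume ∧
          MemLp (AlphaSine.estimate f R N) 2 volume)) ∧
    AlphaSine.IteratedLimitZero (fun B N =>
      eLpNorm (fun y => AlphaSine.fourierTransform f y -
        AlphaSine.bandlimitedInterp f ((N : ℝ) / (2 * B)) N y) 2 volume) ∧
    AlphaSine.IteratedLimitZero (fun B N =>
      eLpNorm (fun x => f x - AlphaSine.estimate f ((N : ℝ) / (2 * B)) N x) 2 volume) := by
  obtain ⟨f', hf', hd⟩ := hderiv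
  have h1 : Integrable f := AlphaSine.integrable_of_even hf1.1 hf1.2.1
  have hpi := Real.pi_pos
  set l : ℝ → ℝ≥0∞ := fun B =>
    eLpNorm (fun x => f x - AlphaSine.truncatedPeriodization (4 * Real.pi * B) f x) 2 volume
    with hl
  have hlim : ∀ B, 0 < B → Tendsto (fun N : ℕ =>
      eLpNorm (fun x => f x - AlphaSine.estimate f ((N : ℝ) / (2 * B)) N x) 2 volume)
      atTop (𝓝 (l B)) := fun B hB =>
    AlphaSine.tendsto_eLpNorm_sub_estimate hd hcont h1 hf' hf2 hB
  have hfin : ∀ B, 0 < B → l B ≠ ⊤ := fun B hB =>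
    (hf2.sub (AlphaSine.memLp_truncatedPeriodization hd hcont h1 hf' (by positivity))).2.ne
  have hzero : Tendsto l atTop (𝓝 0) :=
    (AlphaSine.tendsto_eLpNorm_sub_truncatedPeriodization hd hcont h1 hf' hf2).comp
      (tendsto_id.const_mul_atTop (by positivity))
  set c : ℝ≥0∞ := ENNReal.ofReal (2 * Real.pi) ^ (1 / 2 : ℝ) with hc
  have hctop : c ≠ ⊤ := ENNReal.rpow_ne_top_of_nonneg (by norm_num) ENNReal.ofReal_ne_top
  refine ⟨⟨AlphaSine.memLp_fourierTransform h1 hf2, fun R N hR hN => ⟨?_, ?_⟩⟩, ?_, ?_⟩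
  · rw [← funext (AlphaSine.fourierTransform_estimate f hR hN)]
    exact AlphaSine.memLp_fourierTransform (AlphaSine.integrable_estimate f hR hN)
      (AlphaSine.memLp_estimate f hR hN 2)
  · exact AlphaSine.memLp_estimate f hR hN 2
  -- By Plancherel the error in (i) is `c = √(2π)` times the error in (ii) for every `N ≥ 1`; the
  -- index `N = 0`, where `R = 0`, is discarded in the limit.
  · refine AlphaSine.IteratedLimitZero.of_tendsto (l := fun B => c * l B)
      (fun B hB => ENNReal.mul_ne_top hctop (hfin B hB)) (fun B hB => ?_) ?_
    · refine (ENNReal.Tendsto.const_mul (hlim B hB) (Or.inr hctop)).congr' ?_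
      filter_upwards [eventually_ge_atTop 1] with N hN
      have hN' : (0 : ℝ) < N := by exact_mod_cast hN
      have hR : 0 < (N : ℝ) / (2 * B) := by positivity
      have hi := AlphaSine.integrable_estimate f hR hN
      refine (AlphaSine.eLpNorm_fourierTransform (h1.sub hi)
        (hf2.sub (AlphaSine.memLp_estimate f hR hN 2))).symm.trans ?_
      congr 1
      ext y
      rw [← AlphaSine.fourierTransform_estimate f hR hN]
      exact AlphaSine.fourierTransform_sub h1 hi y
    · simpa using ENNReal.Tendsto.const_mul hzero (Or.inr hctop)
  · exact AlphaSine.IteratedLimitZero.of_tendsto hfin hlim hzero
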